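/- For $\nu\in(0,1]$ and $h,\lambda>0$ let $T_1,T_2,\ldots$ be i.i.d. real random variables having the generalized Mittag-Leffler distribution, i.e. with Lebesgue density $$f_{\nu,h,\lambda}(t)=\lambda^h t^{\nu h-1}E_{\nu,\nu h}^{h}(-\lambda t^\nu)\,1_{(0,\infty)}(t),\qquad E_{\alpha,\beta}^{\gamma}(x)=\sum_{r\ge 0}\frac{(\gamma)_r\,x^r}{r!\,\Gamma(\alpha r+\beta)},$$ where $(\gamma)_0=1$ and $(\gamma)_r=\gamma(\gamma+1)\cdots(\gamma+r-1)$ for $r\ge1$. Let $\kappa(\theta)=\log\mathbb{E}[e^{\theta T_1}]\in(-\infty,\infty]$ for $\theta\in\mathbb{R}$, let $I(x)=\sup_{\theta\in\mathbb{R}}\{\theta x-\kappa(\theta)\}$ for $x\in\mathbb{R}$, and let $\bar T_n=(T_1+\cdots+T_n)/n$. (1) If $\nu\in(0,1)$, then $\kappa(\theta)=h\log\frac{\lambda}{\lambda+(-\theta)^\nu}$ for $\theta\le 0$ and $\kappa(\theta)=\infty$ for $\theta>0$. If $\nu=1$, then $\kappa(\theta)=h\log\frac{\lambda}{\lambda-\theta}$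 for $\theta<\lambda$ and $\kappa(\theta)=\infty$ for $\theta\ge\lambda$. (2) The sequence $\{\bar T_n\}_{n\ge1}$ satisfies the large deviation principle with rate function $I$. That is, $I:\mathbb{R}\to[0,\infty]$ is lower semicontinuous, $\limsup_{n\to\infty}\frac1n\log P(\bar T_n\in C)\le-\inf_{x\in C}I(x)$ for every closed $C\subseteq\mathbb{R}$, and $\liminf_{n\to\infty}\frac1n\log P(\bar T_n\in G)\ge-\inf_{x\in G}I(x)$ for every open $G\subseteq\mathbb{R}$. (3) If $\nu=1$, then $I(x)=h\left(\frac{\lambda x}{h}-1-\log\frac{\lambda x}{h}\right)$ for $x>0$ and $I(x)=\infty$ for $x\le0$. Moreover $I$ is good, i.e. the level sets $\{x: I(x)\le\eta\}$ are compact for all real $\eta\ge0$. (4) If $\nu\in(0,1)$, then $I(x)=\infty$ for $x\le 0$, $I$ is strictly decreasing on $(0,\infty)$, $\lim_{x\downarrow0}I(x)=\infty$, $\lim_{x\to\infty}I(x)=0$, and $I$ is not good. -/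

import Mathlib

open MeasureTheory ProbabilityTheory Filter Topology

noncomputable section

namespace LDP

/-- The large deviation principle (with speed `n`) for a sequence `Z` of random elements of a
topological space, with rate function `I` (values in `[0, ∞]`, as a subset of the extended reals):
`I` is nonnegative and lower semicontinuous, and the upper bound for closed sets and the lower
bound for open sets hold. Here `ENNReal.log 0 = -∞`. -/
structure SatisfiesLDP {Ω 𝒵 : Type*} [MeasurableSpace Ω] [TopologicalSpace 𝒵]
    (P : Measure Ω) (Z : ℕ → Ω → 𝒵) (I : 𝒵 → EReal) : Prop where
  nonneg : ∀ x, 0 ≤ I x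
  lowerSemicontinuous : LowerSemicontinuous I
  upper_bound : ∀ C : Set 𝒵, IsClosed C →
    limsup (fun n : ℕ => (((n : ℝ)⁻¹ : ℝ) : EReal) * ENNReal.log (P {ω | Z n ω ∈ C})) atTop
      ≤ -(⨅ x ∈ C, I x)
  lower_bound : ∀ G : Set 𝒵, IsOpen G →
    -(⨅ x ∈ G, I x) ≤
      liminf (fun n : ℕ => (((n : ℝ)⁻¹ : ℝ) : EReal) * ENNReal.log (P {ω | Z n ω ∈ G})) atTop

/-- A rate function is good if all its level sets `{x | I x ≤ η}`, `0 ≤ η < ∞`, are compact. -/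
def IsGood {𝒵 : Type*} [TopologicalSpace 𝒵] (I : 𝒵 → EReal) : Prop :=
  ∀ η : ℝ, 0 ≤ η → IsCompact {x | I x ≤ (η : EReal)}

/-- The generalized Mittag-Leffler function
`E_{α,β}^γ(x) = ∑_{r ≥ 0} (γ)_r x ^ r / (r! Γ(α r + β))`, where `(γ)_r = γ (γ + 1) ⋯ (γ + r - 1)`
is the rising factorial. -/
def genMittagLeffler (α β γ x : ℝ) : ℝ :=
  ∑' r : ℕ, (ascPochhammer ℝ r).eval γ * x ^ r / ((r.factorial : ℝ) * Real.Gamma (α * r + β))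

/-- The generalized Mittag-Leffler density
`f(t) = lam ^ h * t ^ (ν h - 1) * E_{ν, ν h}^h(-lam * t ^ ν)` for `t > 0`, and `0` elsewhere. -/
def mittagLefflerDensity (ν h lam t : ℝ) : ℝ :=
  if 0 < t then
    lam ^ h * t ^ (ν * h - 1) * genMittagLeffler ν (ν * h) h (-lam * t ^ ν)
  else 0

/-- `X` has the generalized Mittag-Leffler distribution with parameters `ν, h, lam`: its law is
absolutely continuous with respect to Lebesgue measure, with density `mittagLefflerDensity`. -/
def HasMittagLefflerLaw {Ω : Type*} [MeasurableSpace Ω] (P : Measure Ω) (X : Ω → ℝ)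
    (ν h lam : ℝ) : Prop :=
  HasPDF X P volume ∧
    (fun t => (pdf X P volume t).toReal) =ᵐ[volume] mittagLefflerDensity ν h lam

/-- The logarithmic moment generating function `κ(θ) = log E[exp (θ X)] ∈ [-∞, ∞]`. -/
def logMGF {Ω : Type*} [MeasurableSpace Ω] (P : Measure Ω) (X : Ω → ℝ) (θ : ℝ) : EReal :=
  ENNReal.log (∫⁻ ω, ENNReal.ofReal (Real.exp (θ * X ω)) ∂P)

/-- The Legendre transform `x ↦ sup_{θ ∈ ℝ} (θ x - κ(θ))`. -/
def legendre (κ : ℝ → EReal) (x : ℝ) : EReal :=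
  ⨆ θ : ℝ, (((θ * x : ℝ) : EReal) - κ θ)

/-- The empirical mean of the first `n` terms of a sequence; `T i` is the `(i + 1)`-st term. -/
def empiricalMean {Ω : Type*} (T : ℕ → Ω → ℝ) (n : ℕ) (ω : Ω) : ℝ :=
  (∑ i ∈ Finset.range n, T i ω) / n

end LDP

end

/-! The large deviation principle is Cramér's theorem on the line, in the easy case where the
supremum defining `I`, whenever finite, is attained at a slope interior to the domain of `κ`
(`satisfiesLDP_empiricalMean`). The rest is calculus with an explicit `κ`.

For `κ`, integrating the series of the density against `exp (-s t)` term by term gives the binomial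
series of `(1 + lam / s ^ ν) ^ (-h)`. This requires `lam < s ^ ν`; analyticity of the moment
generating function carries the formula to every `θ < 0` (`mgf_eq_of_neg`). If `ν < 1`, a finite
exponential moment at some `θ > 0` would give a finite mean `m`, and Jensen would force `h log (1 +
s ^ ν / lam) ≤ s m`, which fails as `s` decreases to `0`. If `ν = 1` the law is a gamma law.

The upper bound combines Chernoff estimates on half-lines. The lower bound is exponential tilting,
with the change of measure replaced by the pointwise inequality `exp_mul_le_indicator_add`.

For `ν < 1` the slope of `κ` blows up at `0` from the left. Hence for each `x > 0` the optimal slope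
is strictly negative (`exists_pos_forall_slopeValue_le`), which gives both interior attainment and
strict decrease of `I`. Since `I` vanishes at infinity, its level sets are unbounded. -/

namespace LDP

/-! ### Logarithmic moment generating function and integrability. -/

section LogMGF

variable {Ω : Type*} [MeasurableSpace Ω] {P : Measure Ω}

theorem logMGF_of_integrable [IsProbabilityMeasure P] {X : Ω → ℝ} {θ : ℝ}
    (h : Integrable (fun ω => Real.exp (θ * X ω)) P) : logMGF P X θ = (cgf X P θ : EReal) := by
  have h1 : ∫⁻ ω, ENNReal.ofReal (Real.exp (θ * X ω)) ∂P = ENNReal.ofReal (mgf X P θ) :=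
    (ofReal_integral_eq_lintegral_ofReal h (ae_of_all _ fun ω => (Real.exp_pos _).le)).symm
  rw [logMGF, h1, ENNReal.log_ofReal_of_pos (mgf_pos h), cgf]

theorem logMGF_of_not_integrable {X : Ω → ℝ} (hX : AEMeasurable X P) {θ : ℝ}
    (h : ¬ Integrable (fun ω => Real.exp (θ * X ω)) P) : logMGF P X θ = ⊤ := by
  have h1 : ∫⁻ ω, ENNReal.ofReal (Real.exp (θ * X ω)) ∂P = ⊤ := by
    by_contra hne
    exact h ((lintegral_ofReal_ne_top_iff_integrable
      (hX.const_mul θ).exp.aestronglyMeasurable (ae_of_all _ fun ω => (Real.exp_pos _).le)).1 hne)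
  rw [logMGF, h1, ENNReal.log_top]

theorem integrable_of_logMGF_ne_top {X : Ω → ℝ} (hX : AEMeasurable X P) {θ : ℝ}
    (h : logMGF P X θ ≠ ⊤) : Integrable (fun ω => Real.exp (θ * X ω)) P :=
  by_contra fun hn => h (logMGF_of_not_integrable hX hn)

theorem logMGF_zero [IsProbabilityMeasure P] (X : Ω → ℝ) : logMGF P X 0 = 0 := by
  simp [logMGF]

theorem logMGF_mono_of_ae_pos {X : Ω → ℝ} (hX : ∀ᵐ ω ∂P, 0 < X ω) :
    Monotone (logMGF P X) := by
  intro a b hab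
  refine ENNReal.log_monotone (lintegral_mono_ae ?_)
  filter_upwards [hX] with ω hω
  gcongr

end LogMGF

/-! ### General properties of the Legendre transform. -/

section Legendre

theorem le_legendre (κ : ℝ → EReal) (θ x : ℝ) : ((θ * x : ℝ) : EReal) - κ θ ≤ legendre κ x :=
  le_iSup (fun θ : ℝ => ((θ * x : ℝ) : EReal) - κ θ) θ

theorem legendre_nonneg {κ : ℝ → EReal} (h : κ 0 = 0) (x : ℝ) : 0 ≤ legendre κ x := by
  simpa [h] using le_legendre κ 0 x

theorem lowerSemicontinuous_legendre {κ : ℝ → EReal} (h : ∀ θ, κ θ ≠ ⊥) :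
    LowerSemicontinuous (legendre κ) := by
  refine lowerSemicontinuous_iSup fun θ => ?_
  apply Continuous.lowerSemicontinuous
  rcases eq_or_ne (κ θ) ⊤ with ht | ht
  · simp only [ht, EReal.sub_top]
    exact continuous_const
  · lift κ θ to ℝ using ⟨ht, h θ⟩ with c
    simp only [← EReal.coe_sub]
    exact continuous_coe_real_ereal.comp (by fun_prop)

end Legendre

/-! ### From uniform half-line bounds to arbitrary sets. -/

section Cofinal

/-- The half-lines are nested, so their union costs nothing. If `D` has no maximum, Lindelöf covers
it by countably many of them, and the measure of a directed countable union is a supremum, not a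
sum. -/
theorem measure_mem_le_of_forall_le {Ω : Type*} [MeasurableSpace Ω] (P : Measure Ω) (Z : Ω → ℝ)
    {D : Set ℝ} {ε : ENNReal} (h : ∀ x ∈ D, P {ω | Z ω ≤ x} ≤ ε) : P {ω | Z ω ∈ D} ≤ ε := by
  by_cases hmax : ∃ x ∈ D, ∀ y ∈ D, y ≤ x
  · obtain ⟨x, hx, hxD⟩ := hmax
    exact (measure_mono (t := {ω | Z ω ≤ x}) fun ω hω => hxD _ hω).trans (h x hx)
  · push Not at hmax
    obtain ⟨S, hSD, hSc, hS⟩ := TopologicalSpace.isOpen_biUnion_countable D (fun x : ℝ => Set.Iio x)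
      fun _ _ => isOpen_Iio
    calc P {ω | Z ω ∈ D} ≤ P (⋃ x ∈ S, {ω | Z ω ≤ x}) := by
          refine measure_mono fun ω hω => ?_
          obtain ⟨y, hyD, hy⟩ := hmax _ hω
          have : Z ω ∈ ⋃ x ∈ S, Set.Iio x := by
            rw [hS]
            exact Set.mem_biUnion hyD hy
          simp only [Set.mem_iUnion, Set.mem_Iio, exists_prop] at this
          obtain ⟨x, hxS, hx⟩ := this
          exact Set.mem_biUnion hxS hx.le
      _ = ⨆ x ∈ S, P {ω | Z ω ≤ x} := by
          refine measure_biUnion_eq_iSup hSc fun a ha b hb => ?_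
          rcases le_total a b with hab | hab
          · exact ⟨b, hb, fun ω (hω : Z ω ≤ a) => hω.trans hab, subset_rfl⟩
          · exact ⟨a, ha, subset_rfl, fun ω (hω : Z ω ≤ b) => hω.trans hab⟩
      _ ≤ ε := iSup₂_le fun x hx => h x (hSD hx)

end Cofinal

/-! ### Cramér's theorem. -/

section Cramer

variable {Ω : Type*} [MeasurableSpace Ω] {P : Measure Ω} {T : ℕ → Ω → ℝ}

theorem mgf_sum_range (hmeas : ∀ n, Measurable (T n)) (hindep : iIndepFun T P)
    (hident : ∀ n, IdentDistrib (T n) (T 0) P P) (θ : ℝ) (n : ℕ) :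
    mgf (fun ω => ∑ i ∈ Finset.range n, T i ω) P θ = mgf (T 0) P θ ^ n := by
  have h := hindep.mgf_sum (t := θ) hmeas (Finset.range n)
  rw [Finset.prod_congr rfl fun i _ => mgf_congr_of_identDistrib (T i) (T 0) (hident i) θ] at h
  simpa [Finset.sum_fn] using h

variable [IsProbabilityMeasure P]

theorem integrable_exp_mul_sum_range (hmeas : ∀ n, Measurable (T n)) (hindep : iIndepFun T P)
    (hident : ∀ n, IdentDistrib (T n) (T 0) P P) {θ : ℝ}
    (hθ : Integrable (fun ω => Real.exp (θ * T 0 ω)) P) (n : ℕ) :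
    Integrable (fun ω => Real.exp (θ * ∑ i ∈ Finset.range n, T i ω)) P := by
  have h := hindep.integrable_exp_mul_sum (t := θ) hmeas (s := Finset.range n) fun i _ =>
    ((hident i).comp (measurable_const_mul θ).exp).integrable_iff.2 hθ
  simpa using h

theorem measure_empiricalMean_le (hmeas : ∀ n, Measurable (T n)) (hindep : iIndepFun T P)
    (hident : ∀ n, IdentDistrib (T n) (T 0) P P) {θ : ℝ} (hθ0 : θ ≤ 0)
    (hθ : Integrable (fun ω => Real.exp (θ * T 0 ω)) P) {n : ℕ} (hn : 0 < n) (x : ℝ) :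
    P {ω | empiricalMean T n ω ≤ x} ≤
      ENNReal.ofReal (Real.exp (-(n * (θ * x - cgf (T 0) P θ)))) := by
  have hn' : (0 : ℝ) < n := by exact_mod_cast hn
  have h := measure_le_le_exp_mul_mgf (X := fun ω => ∑ i ∈ Finset.range n, T i ω) (n * x) hθ0
    (integrable_exp_mul_sum_range hmeas hindep hident hθ n)
  rw [mgf_sum_range hmeas hindep hident, ← exp_cgf hθ, ← Real.exp_nat_mul, ← Real.exp_add] at h
  have hset : {ω | empiricalMean T n ω ≤ x} = {ω | ∑ i ∈ Finset.range n, T i ω ≤ n * x} := by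
    ext ω
    simp [empiricalMean, div_le_iff₀ hn', mul_comm]
  rw [hset, ← ofReal_measureReal]
  refine ENNReal.ofReal_le_ofReal (h.trans_eq ?_)
  ring_nf

theorem measure_le_empiricalMean (hmeas : ∀ n, Measurable (T n)) (hindep : iIndepFun T P)
    (hident : ∀ n, IdentDistrib (T n) (T 0) P P) {θ : ℝ} (hθ0 : 0 ≤ θ)
    (hθ : Integrable (fun ω => Real.exp (θ * T 0 ω)) P) {n : ℕ} (hn : 0 < n) (x : ℝ) :
    P {ω | x ≤ empiricalMean T n ω} ≤
      ENNReal.ofReal (Real.exp (-(n * (θ * x - cgf (T 0) P θ)))) := by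
  have hn' : (0 : ℝ) < n := by exact_mod_cast hn
  have h := measure_ge_le_exp_mul_mgf (X := fun ω => ∑ i ∈ Finset.range n, T i ω) (n * x) hθ0
    (integrable_exp_mul_sum_range hmeas hindep hident hθ n)
  rw [mgf_sum_range hmeas hindep hident, ← exp_cgf hθ, ← Real.exp_nat_mul, ← Real.exp_add] at h
  have hset : {ω | x ≤ empiricalMean T n ω} = {ω | n * x ≤ ∑ i ∈ Finset.range n, T i ω} := by
    ext ω
    simp [empiricalMean, le_div_iff₀ hn', mul_comm]
  rw [hset, ← ofReal_measureReal]
  refine ENNReal.ofReal_le_ofReal (h.trans_eq ?_)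
  ring_nf

/-- Every point at which the Legendre transform exceeds `b` has a slope certifying this. -/
theorem exists_lt_of_lt_legendre {κ : ℝ → EReal} {x : ℝ} {b : ℝ}
    (h : (b : EReal) < legendre κ x) :
    ∃ θ : ℝ, κ θ ≠ ⊤ ∧ (b : EReal) < ((θ * x : ℝ) : EReal) - κ θ := by
  obtain ⟨θ, hθ⟩ := lt_iSup_iff.1 h
  refine ⟨θ, fun ht => ?_, hθ⟩
  simp [ht] at hθ

/-- The sign of the certifying slope decides which half-line at `x` is exponentially small.
Splitting `C` by this alternative yields the factor `2`; neither closedness nor compactness of `C`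
plays a role. -/
theorem measure_empiricalMean_mem_le (hmeas : ∀ n, Measurable (T n)) (hindep : iIndepFun T P)
    (hident : ∀ n, IdentDistrib (T n) (T 0) P P)
    {C : Set ℝ} {b : ℝ} (hb : ∀ x ∈ C, (b : EReal) < legendre (logMGF P (T 0)) x)
    {n : ℕ} (hn : 0 < n) :
    P {ω | empiricalMean T n ω ∈ C} ≤ ENNReal.ofReal (2 * Real.exp (-(n * b))) := by
  have key : ∀ x ∈ C, P {ω | empiricalMean T n ω ≤ x} ≤ ENNReal.ofReal (Real.exp (-(n * b))) ∨
      P {ω | x ≤ empiricalMean T n ω} ≤ ENNReal.ofReal (Real.exp (-(n * b))) := by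
    intro x hx
    obtain ⟨θ, hfin, hθ⟩ := exists_lt_of_lt_legendre (hb x hx)
    have hint := integrable_of_logMGF_ne_top (hmeas 0).aemeasurable hfin
    rw [logMGF_of_integrable hint, ← EReal.coe_sub, EReal.coe_lt_coe_iff] at hθ
    have hexp : ENNReal.ofReal (Real.exp (-(n * (θ * x - cgf (T 0) P θ)))) ≤
        ENNReal.ofReal (Real.exp (-(n * b))) := by gcongr
    rcases le_total θ 0 with h0 | h0
    · exact Or.inl ((measure_empiricalMean_le hmeas hindep hident h0 hint hn x).trans hexp)
    · exact Or.inr ((measure_le_empiricalMean hmeas hindep hident h0 hint hn x).trans hexp)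
  have h1 : P {ω | empiricalMean T n ω ∈ {x ∈ C | P {ω | empiricalMean T n ω ≤ x} ≤
      ENNReal.ofReal (Real.exp (-(n * b)))}} ≤ ENNReal.ofReal (Real.exp (-(n * b))) :=
    measure_mem_le_of_forall_le P _ fun x hx => hx.2
  -- Reflection turns right half-lines into left ones, so the same covering lemma applies.
  have h2 : P {ω | -empiricalMean T n ω ∈ {y | -y ∈ {x ∈ C | P {ω | x ≤ empiricalMean T n ω} ≤
      ENNReal.ofReal (Real.exp (-(n * b)))}}} ≤ ENNReal.ofReal (Real.exp (-(n * b))) :=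
    measure_mem_le_of_forall_le P _ fun y hy => by simpa only [neg_le] using! hy.2
  rw [two_mul, ENNReal.ofReal_add (Real.exp_pos _).le (Real.exp_pos _).le]
  refine le_trans ((measure_mono fun ω hω => ?_).trans (measure_union_le _ _)) (add_le_add h1 h2)
  rcases key _ hω with h | h
  · exact Or.inl ⟨hω, h⟩
  · refine Or.inr ?_
    simp only [Set.mem_ofPred_eq, neg_neg]
    exact ⟨hω, h⟩

theorem tendsto_inv_mul_add_mul (a b : ℝ) :
    Tendsto (fun n : ℕ => (((n : ℝ)⁻¹ * (a + n * b) : ℝ) : EReal)) atTop (𝓝 (b : EReal)) := by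
  refine (continuous_coe_real_ereal.tendsto b).comp ?_
  have h1 : Tendsto (fun n : ℕ => (n : ℝ)⁻¹ * a + b) atTop (𝓝 (0 * a + b)) :=
    ((tendsto_inv_atTop_zero.comp tendsto_natCast_atTop_atTop).mul_const a).add_const b
  rw [zero_mul, zero_add] at h1
  refine h1.congr' ?_
  filter_upwards [eventually_gt_atTop 0] with n hn
  have : (n : ℝ) ≠ 0 := by exact_mod_cast hn.ne'
  field_simp

theorem limsup_log_measure_le (hmeas : ∀ n, Measurable (T n)) (hindep : iIndepFun T P)
    (hident : ∀ n, IdentDistrib (T n) (T 0) P P) (C : Set ℝ) :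
    limsup (fun n : ℕ => (((n : ℝ)⁻¹ : ℝ) : EReal) *
        ENNReal.log (P {ω | empiricalMean T n ω ∈ C})) atTop
      ≤ -(⨅ x ∈ C, legendre (logMGF P (T 0)) x) := by
  rw [EReal.le_neg]
  refine EReal.ge_of_forall_gt_iff_ge.1 fun b hb => ?_
  rw [EReal.le_neg, ← EReal.coe_neg, ← (tendsto_inv_mul_add_mul (Real.log 2) (-b)).limsup_eq]
  refine limsup_le_limsup ?_
  filter_upwards [eventually_gt_atTop 0] with n hn
  have h := measure_empiricalMean_mem_le hmeas hindep hident (C := C) (b := b)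
    (fun x hx => hb.trans_le (iInf₂_le x hx)) hn
  rw [EReal.coe_mul]
  refine mul_le_mul_of_nonneg_left ?_ (by exact_mod_cast inv_nonneg.2 (Nat.cast_nonneg n))
  refine (ENNReal.log_monotone h).trans_eq ?_
  rw [ENNReal.log_ofReal_of_pos (by positivity), Real.log_mul (by norm_num) (Real.exp_pos _).ne',
    Real.log_exp, mul_neg]

/-- The first-order error is at most `ε * δ / 2`, which the margin `ε * δ` beats on both sides.
These negative exponents make the tilted probability of leaving the `δ`-window decay geometrically.
-/
theorem exists_pos_lt_of_hasDerivAt {c : ℝ → ℝ} {θ x : ℝ} {s : Set ℝ} (hs : s ∈ 𝓝 θ)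
    (h : HasDerivAt c x θ) {δ : ℝ} (hδ : 0 < δ) :
    ∃ ε > 0, θ + ε ∈ s ∧ θ - ε ∈ s ∧ c (θ + ε) - c θ - ε * (x + δ) < 0 ∧
      c (θ - ε) - c θ + ε * (x - δ) < 0 := by
  have h1 := (hasDerivAt_iff_isLittleO.1 h).def (half_pos hδ)
  obtain ⟨r, hr, hball⟩ := Metric.eventually_nhds_iff.1 (h1.and hs)
  have hp := hball (y := θ + r / 2) (by simp [abs_of_pos hr]; linarith)
  have hm := hball (y := θ - r / 2) (by simp [abs_of_pos hr]; linarith)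
  refine ⟨r / 2, half_pos hr, hp.2, hm.2, ?_, ?_⟩
  · have := (le_abs_self _).trans hp.1
    simp only [add_sub_cancel_left, smul_eq_mul, Real.norm_eq_abs, abs_of_pos (half_pos hr)] at this
    nlinarith
  · have := (le_abs_self _).trans hm.1
    simp only [sub_sub_cancel_left, smul_eq_mul, Real.norm_eq_abs, abs_neg,
      abs_of_pos (half_pos hr)] at this
    nlinarith

/-- Inside the window the exponent is controlled directly; to its right `exp (ε * (s - n * (x + δ)))
≥ 1`, and symmetrically to its left. Integration then bounds the window's probability from below
without a tilted measure. -/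
theorem exp_mul_le_indicator_add (θ x δ ε s : ℝ) {n : ℕ} (hn : 0 < n) (hε : 0 < ε) :
    Real.exp (θ * s) ≤
      Set.indicator {s : ℝ | |s / n - x| < δ}
        (fun _ => Real.exp (n * (θ * x + |θ| * δ))) s
      + Real.exp (-(n * (ε * (x + δ)))) * Real.exp ((θ + ε) * s)
      + Real.exp (n * (ε * (x - δ))) * Real.exp ((θ - ε) * s) := by
  have hn' : (0 : ℝ) < n := by exact_mod_cast hn
  have hind : 0 ≤ Set.indicator {s : ℝ | |s / n - x| < δ}
      (fun _ => Real.exp (n * (θ * x + |θ| * δ))) s :=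
    Set.indicator_nonneg (fun _ _ => (Real.exp_pos _).le) _
  rw [← Real.exp_add, ← Real.exp_add]
  rcases lt_or_ge |s / n - x| δ with h | h
  · rw [Set.indicator_of_mem (by exact h)]
    have h1 : θ * s ≤ n * (θ * x + |θ| * δ) := by
      have h2 : θ * (s / n - x) ≤ |θ| * δ :=
        (le_abs_self _).trans (by rw [abs_mul]; gcongr)
      calc θ * s = n * (θ * x + θ * (s / n - x)) := by field_simp; ring
        _ ≤ _ := by gcongr
    have := Real.exp_le_exp.2 h1
    have := Real.exp_pos (-(n * (ε * (x + δ))) + (θ + ε) * s)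
    have := Real.exp_pos (n * (ε * (x - δ)) + (θ - ε) * s)
    linarith
  · rcases le_abs.1 h with h | h
    · have h3 : n * (x + δ) ≤ s := by
        have : x + δ ≤ s / n := by linarith
        rwa [le_div_iff₀' hn'] at this
      have := Real.exp_le_exp.2 (show θ * s ≤ -(n * (ε * (x + δ))) + (θ + ε) * s by nlinarith)
      have := Real.exp_pos (n * (ε * (x - δ)) + (θ - ε) * s)
      linarith
    · have h3 : s ≤ n * (x - δ) := by
        have : s / n ≤ x - δ := by linarith
        rwa [div_le_iff₀' hn'] at this
      have := Real.exp_le_exp.2 (show θ * s ≤ n * (ε * (x - δ)) + (θ - ε) * s by nlinarith)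
      have := Real.exp_pos (-(n * (ε * (x + δ))) + (θ + ε) * s)
      linarith

theorem one_le_measure_ball_add (hmeas : ∀ n, Measurable (T n)) (hindep : iIndepFun T P)
    (hident : ∀ n, IdentDistrib (T n) (T 0) P P) {θ ε x δ : ℝ} (hε : 0 < ε)
    (hθ : θ ∈ integrableExpSet (T 0) P) (hp : θ + ε ∈ integrableExpSet (T 0) P)
    (hm : θ - ε ∈ integrableExpSet (T 0) P) {n : ℕ} (hn : 0 < n) :
    1 ≤ P.real {ω | |empiricalMean T n ω - x| < δ} *
          Real.exp (n * (θ * x + |θ| * δ - cgf (T 0) P θ))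
      + Real.exp (cgf (T 0) P (θ + ε) - cgf (T 0) P θ - ε * (x + δ)) ^ n
      + Real.exp (cgf (T 0) P (θ - ε) - cgf (T 0) P θ + ε * (x - δ)) ^ n := by
  have hi := fun t (ht : t ∈ integrableExpSet (T 0) P) =>
    integrable_exp_mul_sum_range hmeas hindep hident (θ := t) ht n
  have hmgf := fun t (ht : t ∈ integrableExpSet (T 0) P) =>
    (mgf_sum_range hmeas hindep hident t n).trans (by rw [← exp_cgf ht, ← Real.exp_nat_mul])
  have hSm : Measurable fun ω => ∑ i ∈ Finset.range n, T i ω :=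
    Finset.measurable_sum _ fun i _ => hmeas i
  have hset : MeasurableSet {ω | |empiricalMean T n ω - x| < δ} :=
    measurableSet_lt (((hSm.div_const _).sub_const x).abs) measurable_const
  have hi0 : Integrable (Set.indicator {ω | |empiricalMean T n ω - x| < δ}
      fun _ => Real.exp (n * (θ * x + |θ| * δ))) P := (integrable_const _).indicator hset
  have hi1 := (hi _ hp).const_mul (Real.exp (-(n * (ε * (x + δ)))))
  have hi2 := (hi _ hm).const_mul (Real.exp (n * (ε * (x - δ))))
  have h : _ ≤ _ := integral_mono (hi θ hθ) ((hi0.add hi1).add hi2)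
    fun ω => exp_mul_le_indicator_add θ x δ ε (∑ i ∈ Finset.range n, T i ω) hn hε
  rw [integral_add' (hi0.add hi1) hi2, integral_add' hi0 hi1, integral_const_mul,
    integral_const_mul, integral_indicator_const _ hset, smul_eq_mul] at h
  have e1 := hmgf _ hθ
  have e2 := hmgf _ hp
  have e3 := hmgf _ hm
  simp only [mgf] at e1 e2 e3
  rw [e1, e2, e3] at h
  -- Division by the `n`-th power of the moment generating function at `θ` normalises the left side
  -- to `1`.
  have h' := mul_le_mul_of_nonneg_right h (Real.exp_pos (-(n * cgf (T 0) P θ))).le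
  rw [← Real.exp_add, add_neg_cancel, Real.exp_zero] at h'
  refine h'.trans_eq ?_
  rw [← Real.exp_nat_mul, ← Real.exp_nat_mul, add_mul, add_mul, mul_assoc, ← Real.exp_add,
    ← Real.exp_add, ← Real.exp_add, ← Real.exp_add, ← Real.exp_add]
  refine congrArg₂ (· + ·) (congrArg₂ (· + ·) (congrArg₂ (· * ·) rfl ?_) ?_) ?_ <;>
  · congr 1
    ring

theorem le_liminf_log_measure_ball (hmeas : ∀ n, Measurable (T n)) (hindep : iIndepFun T P)
    (hident : ∀ n, IdentDistrib (T n) (T 0) P P) {θ x δ : ℝ} (hδ : 0 < δ)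
    (hθ : θ ∈ interior (integrableExpSet (T 0) P)) (hderiv : HasDerivAt (cgf (T 0) P) x θ) :
    (((cgf (T 0) P θ - θ * x) - |θ| * δ : ℝ) : EReal) ≤
      liminf (fun n : ℕ => (((n : ℝ)⁻¹ : ℝ) : EReal) *
        ENNReal.log (P {ω | |empiricalMean T n ω - x| < δ})) atTop := by
  obtain ⟨ε, hε, hp, hm, h1, h2⟩ :=
    exists_pos_lt_of_hasDerivAt (mem_interior_iff_mem_nhds.1 hθ) hderiv hδ
  have hlim := (tendsto_pow_atTop_nhds_zero_of_lt_one (Real.exp_pos _).le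
    (Real.exp_lt_one_iff.2 h1)).add (tendsto_pow_atTop_nhds_zero_of_lt_one (Real.exp_pos _).le
    (Real.exp_lt_one_iff.2 h2))
  rw [add_zero] at hlim
  rw [← (tendsto_inv_mul_add_mul (Real.log (1 / 2))
    ((cgf (T 0) P θ - θ * x) - |θ| * δ)).liminf_eq]
  refine liminf_le_liminf ?_
  -- Once the two tail terms sum to less than `1 / 2`, the window term is at least `1 / 2`, a
  -- constant that disappears at exponential scale.
  filter_upwards [hlim.eventually_lt_const (show (0 : ℝ) < 1 / 2 by norm_num),
    eventually_gt_atTop 0] with n hn hn0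
  have h := one_le_measure_ball_add hmeas hindep hident (x := x) (δ := δ) hε
    (interior_subset hθ) hp hm hn0
  have hP : 1 / 2 * Real.exp (n * ((cgf (T 0) P θ - θ * x) - |θ| * δ)) ≤
      P.real {ω | |empiricalMean T n ω - x| < δ} := by
    have h3 : 1 / 2 ≤ P.real {ω | |empiricalMean T n ω - x| < δ} *
          Real.exp (n * (θ * x + |θ| * δ - cgf (T 0) P θ)) := by linarith
    calc _ ≤ P.real {ω | |empiricalMean T n ω - x| < δ} *
          Real.exp (n * (θ * x + |θ| * δ - cgf (T 0) P θ)) *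
          Real.exp (n * ((cgf (T 0) P θ - θ * x) - |θ| * δ)) := by gcongr
      _ = P.real {ω | |empiricalMean T n ω - x| < δ} := by
        rw [mul_assoc, ← Real.exp_add, ← mul_add, show θ * x + |θ| * δ - cgf (T 0) P θ +
          (cgf (T 0) P θ - θ * x - |θ| * δ) = 0 by ring, mul_zero, Real.exp_zero, mul_one]
  have hpos : 0 < 1 / 2 * Real.exp (n * ((cgf (T 0) P θ - θ * x) - |θ| * δ)) := by positivity
  rw [EReal.coe_mul]
  refine mul_le_mul_of_nonneg_left ?_ (by exact_mod_cast inv_nonneg.2 (Nat.cast_nonneg n))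
  rw [← ofReal_measureReal, ENNReal.log_ofReal_of_pos (hpos.trans_le hP), EReal.coe_le_coe_iff]
  refine le_trans (le_of_eq ?_) (Real.log_le_log hpos hP)
  rw [Real.log_mul (by norm_num) (Real.exp_pos _).ne', Real.log_exp]

/-- If the supremum defining `legendre` is attained at an interior slope, that slope has
derivative `x`. -/
theorem hasDerivAt_cgf_of_legendre_le {X : Ω → ℝ} {θ x : ℝ}
    (hθ : θ ∈ interior (integrableExpSet X P))
    (h : legendre (logMGF P X) x ≤ ((θ * x - cgf X P θ : ℝ) : EReal)) :
    HasDerivAt (cgf X P) x θ := by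
  have hd : HasDerivAt (cgf X P) (deriv (cgf X P) θ) θ :=
    (analyticAt_cgf hθ).differentiableAt.hasDerivAt
  have hmax : IsLocalMax (fun t => t * x - cgf X P t) θ := by
    filter_upwards [mem_interior_iff_mem_nhds.1 hθ] with t ht
    have h1 := (le_legendre (logMGF P X) t x).trans h
    rw [logMGF_of_integrable ht, ← EReal.coe_sub, EReal.coe_le_coe_iff] at h1
    exact h1
  have h0 := hmax.hasDerivAt_eq_zero (((hasDerivAt_id θ).mul_const x).sub hd)
  have : deriv (cgf X P) θ = x := by linarith
  rwa [this] at hd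

/-- **Cramér's theorem** on the real line, when the Legendre transform is attained in the interior
of the domain of the moment generating function wherever it is finite. -/
theorem satisfiesLDP_empiricalMean (hmeas : ∀ n, Measurable (T n)) (hindep : iIndepFun T P)
    (hident : ∀ n, IdentDistrib (T n) (T 0) P P)
    (hattain : ∀ x, legendre (logMGF P (T 0)) x ≠ ⊤ →
      ∃ θ ∈ interior (integrableExpSet (T 0) P),
        legendre (logMGF P (T 0)) x ≤ ((θ * x - cgf (T 0) P θ : ℝ) : EReal)) :
    SatisfiesLDP P (empiricalMean T) (legendre (logMGF P (T 0))) where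
  nonneg := legendre_nonneg (logMGF_zero _)
  lowerSemicontinuous := by
    refine lowerSemicontinuous_legendre fun θ => ?_
    by_cases h : Integrable (fun ω => Real.exp (θ * T 0 ω)) P
    · rw [logMGF_of_integrable h]
      exact EReal.coe_ne_bot _
    · rw [logMGF_of_not_integrable (hmeas 0).aemeasurable h]
      exact top_ne_bot
  upper_bound C _ := limsup_log_measure_le hmeas hindep hident C
  lower_bound G hG := by
    rw [EReal.neg_le]
    refine le_iInf₂ fun x hx => ?_
    rw [EReal.neg_le]
    rcases eq_or_ne (legendre (logMGF P (T 0)) x) ⊤ with htop | htop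
    · simp [htop]
    obtain ⟨θ, hθ, hle⟩ := hattain x htop
    have hderiv := hasDerivAt_cgf_of_legendre_le hθ hle
    have heq : (((θ * x - cgf (T 0) P θ : ℝ)) : EReal) ≤ legendre (logMGF P (T 0)) x := by
      have := le_legendre (logMGF P (T 0)) θ x
      rwa [logMGF_of_integrable (show θ ∈ integrableExpSet (T 0) P from interior_subset hθ),
        ← EReal.coe_sub] at this
    refine (EReal.neg_le_neg_iff.2 heq).trans ?_
    rw [← EReal.coe_neg, neg_sub]
    obtain ⟨r, hr, hball⟩ := Metric.isOpen_iff.1 hG x hx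
    -- Shrinking the window removes the loss `|θ| * δ`.
    have hlim : Tendsto (fun δ : ℝ => (((cgf (T 0) P θ - θ * x) - |θ| * δ : ℝ) : EReal)) (𝓝[>] 0)
        (𝓝 ((cgf (T 0) P θ - θ * x : ℝ) : EReal)) := by
      have hc : Continuous
          fun δ : ℝ => (((cgf (T 0) P θ - θ * x) - |θ| * δ : ℝ) : EReal) :=
        continuous_coe_real_ereal.comp (by fun_prop)
      simpa using (hc.tendsto 0).mono_left nhdsWithin_le_nhds
    refine le_of_tendsto hlim ?_
    filter_upwards [Ioo_mem_nhdsGT hr] with δ hδ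
    refine (le_liminf_log_measure_ball hmeas hindep hident hδ.1 hθ hderiv).trans ?_
    refine liminf_le_liminf (Eventually.of_forall fun n => ?_)
    refine mul_le_mul_of_nonneg_left ?_ (by exact_mod_cast inv_nonneg.2 (Nat.cast_nonneg n))
    refine ENNReal.log_monotone (measure_mono fun ω hω => hball ?_)
    rw [Metric.mem_ball, Real.dist_eq]
    exact lt_trans hω hδ.2

end Cramer

/-! ### Consequences of having the Mittag-Leffler density. -/

section Law

variable {Ω : Type*} [MeasurableSpace Ω] {P : Measure Ω} [IsProbabilityMeasure P]
  {X : Ω → ℝ} {ν h lam : ℝ}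

theorem HasMittagLefflerLaw.pdf_ae_eq (hX : HasMittagLefflerLaw P X ν h lam) :
    pdf X P volume =ᵐ[volume] fun t => ENNReal.ofReal (mittagLefflerDensity ν h lam t) := by
  have h0 : (fun t => ENNReal.ofReal (pdf X P volume t).toReal) =ᵐ[volume] pdf X P volume :=
    pdf.ofReal_toReal_ae_eq
  filter_upwards [h0, hX.2] with t h1 h2
  rw [← h1, h2]

theorem HasMittagLefflerLaw.ae_pos (hX : HasMittagLefflerLaw P X ν h lam) :
    ∀ᵐ ω ∂P, 0 < X ω := by
  have := hX.1
  have h1 : Measure.map X P (Set.Iic 0) = 0 := by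
    rw [map_eq_setLIntegral_pdf X P volume measurableSet_Iic,
      setLIntegral_congr_fun_ae measurableSet_Iic (g := fun _ => 0), lintegral_zero]
    filter_upwards [hX.pdf_ae_eq] with t ht ht0
    rw [ht, mittagLefflerDensity, if_neg (not_lt.2 ht0), ENNReal.ofReal_zero]
  rw [Measure.map_apply_of_aemeasurable (HasPDF.aemeasurable X P volume) measurableSet_Iic] at h1
  rw [ae_iff]
  simpa [Set.preimage] using! h1

theorem HasMittagLefflerLaw.identDistrib {Y : Ω → ℝ} (hX : HasMittagLefflerLaw P X ν h lam)
    (hY : HasMittagLefflerLaw P Y ν h lam) : IdentDistrib X Y P P := by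
  have := hX.1
  have := hY.1
  refine ⟨HasPDF.aemeasurable X P volume, HasPDF.aemeasurable Y P volume, ?_⟩
  rw [map_eq_withDensity_pdf X P volume, map_eq_withDensity_pdf Y P volume]
  exact withDensity_congr_ae (hX.pdf_ae_eq.trans hY.pdf_ae_eq.symm)

theorem integrable_exp_mul_of_ae_pos (hXm : AEMeasurable X P) (hX : ∀ᵐ ω ∂P, 0 < X ω) {θ : ℝ}
    (hθ : θ ≤ 0) : Integrable (fun ω => Real.exp (θ * X ω)) P := by
  refine Integrable.of_bound (hXm.const_mul θ).exp.aestronglyMeasurable 1 ?_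
  filter_upwards [hX] with ω hω
  rw [Real.norm_eq_abs, Real.abs_exp, Real.exp_le_one_iff]
  exact mul_nonpos_of_nonpos_of_nonneg hθ hω.le

theorem Iio_zero_subset_interior_integrableExpSet (hXm : AEMeasurable X P)
    (hX : ∀ᵐ ω ∂P, 0 < X ω) : Set.Iio 0 ⊆ interior (integrableExpSet X P) :=
  interior_maximal (fun _ hθ => integrable_exp_mul_of_ae_pos hXm hX (le_of_lt hθ)) isOpen_Iio

end Law

/-! ### Laplace transform of the density at large argument. -/

theorem hasSum_ascPochhammer_mul_pow (h : ℝ) {y : ℝ} (hy : |y| < 1) :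
    HasSum (fun r : ℕ => (ascPochhammer ℝ r).eval h / (r.factorial : ℝ) * y ^ r)
      (1 / (1 - y) ^ h) := by
  have h1 := (Real.one_div_one_sub_rpow_hasFPowerSeriesOnBall_zero h).hasSum (y := y)
    (by rw [← ENNReal.ofReal_one, Metric.eball_ofReal]; simpa using hy)
  rw [zero_add] at h1
  refine h1.congr_fun fun r => ?_
  have h2 : (r.factorial : ℝ) * Ring.choose (h + r - 1) r = (ascPochhammer ℝ r).eval h := by
    rw [← Ring.multichoose_eq, ← nsmul_eq_mul, Ring.factorial_nsmul_multichoose_eq_ascPochhammer,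
      Polynomial.ascPochhammer_smeval_eq_eval]
  have h3 : (r.factorial : ℝ) ≠ 0 := by exact_mod_cast r.factorial_ne_zero
  rw [← h2, mul_div_cancel_left₀ _ h3]
  simp [FormalMultilinearSeries.ofScalars]

section Laplace

variable {ν h lam s : ℝ}

/-- The terms of the series of the density times `exp (-(s t))`. -/
noncomputable def laplaceTerm (ν h lam s : ℝ) (r : ℕ) (t : ℝ) : ℝ :=
  lam ^ h * ((ascPochhammer ℝ r).eval h / (r.factorial : ℝ)) * (-lam) ^ r /
    Real.Gamma (ν * r + ν * h) * (t ^ (ν * r + ν * h - 1) * Real.exp (-(s * t)))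

theorem density_mul_exp_eq_tsum {t : ℝ} (ht : 0 < t) :
    mittagLefflerDensity ν h lam t * Real.exp (-s * t) = ∑' r, laplaceTerm ν h lam s r t := by
  rw [mittagLefflerDensity, if_pos ht, genMittagLeffler, ← tsum_mul_left, ← tsum_mul_right]
  refine tsum_congr fun r => ?_
  rw [laplaceTerm, mul_pow, ← Real.rpow_natCast (t ^ ν), ← Real.rpow_mul ht.le,
    show ν * r + ν * h - 1 = (ν * h - 1) + ν * r by ring, Real.rpow_add ht]
  ring_nf

theorem integral_laplaceTerm (hν : 0 < ν) (hh : 0 < h) (hs : 0 < s) (r : ℕ) :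
    ∫ t in Set.Ioi 0, laplaceTerm ν h lam s r t =
      lam ^ h * (s ^ ν)⁻¹ ^ h *
        ((ascPochhammer ℝ r).eval h / (r.factorial : ℝ) * (-(lam / s ^ ν)) ^ r) := by
  have ha : 0 < ν * r + ν * h := by positivity
  have hG := (Real.Gamma_pos_of_pos ha).ne'
  simp only [laplaceTerm]
  rw [integral_const_mul, Real.integral_rpow_mul_exp_neg_mul_Ioi ha hs,
    Real.rpow_add (by positivity),
    Real.rpow_mul (by positivity), Real.rpow_mul (by positivity), Real.rpow_natCast, one_div,
    Real.inv_rpow hs.le]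
  have h2 : (-(lam / s ^ ν)) ^ r = (-lam) ^ r * (s ^ ν)⁻¹ ^ r := by
    rw [← mul_pow]; congr 1; ring
  rw [h2]
  field_simp

theorem integrableOn_laplaceTerm (hν : 0 < ν) (hh : 0 < h) (hs : 0 < s) (r : ℕ) :
    IntegrableOn (laplaceTerm ν h lam s r) (Set.Ioi 0) := by
  have ha : 0 < ν * r + ν * h := by positivity
  refine Integrable.const_mul ?_ _
  refine Integrable.of_integral_ne_zero ?_
  rw [Real.integral_rpow_mul_exp_neg_mul_Ioi ha hs]
  have := Real.Gamma_pos_of_pos ha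
  positivity

/-- The sign of the `r`-th term is `(-1) ^ r` throughout the half-line, so taking norms only
replaces `-lam` by `lam` in the power. -/
theorem integral_norm_laplaceTerm (hν : 0 < ν) (hh : 0 < h) (hlam : 0 < lam) (hs : 0 < s) (r : ℕ) :
    ∫ t in Set.Ioi 0, ‖laplaceTerm ν h lam s r t‖ =
      lam ^ h * (s ^ ν)⁻¹ ^ h *
        ((ascPochhammer ℝ r).eval h / (r.factorial : ℝ) * (lam / s ^ ν) ^ r) := by
  have h1 : ∀ t ∈ Set.Ioi (0 : ℝ), ‖laplaceTerm ν h lam s r t‖ =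
      (-1) ^ r * laplaceTerm ν h lam s r t := by
    intro t ht
    have ht' : 0 < t := ht
    have hG := Real.Gamma_pos_of_pos (show 0 < ν * r + ν * h by positivity)
    have hA := ascPochhammer_pos r h hh
    have h2 : (-1) ^ r * laplaceTerm ν h lam s r t =
        lam ^ h * ((ascPochhammer ℝ r).eval h / (r.factorial : ℝ)) * lam ^ r /
          Real.Gamma (ν * r + ν * h) * (t ^ (ν * r + ν * h - 1) * Real.exp (-(s * t))) := by
      rw [laplaceTerm, show lam ^ r = (-1) ^ r * (-lam) ^ r by rw [← mul_pow]; simp]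
      ring
    have h3 : 0 < (-1) ^ r * laplaceTerm ν h lam s r t := by
      rw [h2]
      positivity
    rw [← abs_of_pos h3, abs_mul, abs_pow, abs_neg, abs_one, one_pow, one_mul, Real.norm_eq_abs]
  rw [setIntegral_congr_fun measurableSet_Ioi h1, integral_const_mul,
    integral_laplaceTerm hν hh hs, neg_pow (lam / s ^ ν)]
  have : ((-1 : ℝ)) ^ r * (-1) ^ r = 1 := by rw [← mul_pow]; simp
  linear_combination (lam ^ h * (s ^ ν)⁻¹ ^ h *
        ((ascPochhammer ℝ r).eval h / (r.factorial : ℝ) * (lam / s ^ ν) ^ r)) * this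

/-- The condition `lam < s ^ ν` makes the binomial series of the integrated norms converge, which
justifies exchanging sum and integral. -/
theorem integral_density_mul_exp (hν : 0 < ν) (hh : 0 < h) (hlam : 0 < lam) (hs : 0 < s)
    (hlt : lam < s ^ ν) :
    ∫ t, mittagLefflerDensity ν h lam t * Real.exp (-s * t) = (lam / (lam + s ^ ν)) ^ h := by
  have hsν : 0 < s ^ ν := Real.rpow_pos_of_pos hs ν
  have hq : lam / s ^ ν < 1 := (div_lt_one hsν).2 hlt
  have hq0 : 0 < lam / s ^ ν := by positivity
  have h0 : ∫ t, mittagLefflerDensity ν h lam t * Real.exp (-s * t) =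
      ∫ t in Set.Ioi 0, mittagLefflerDensity ν h lam t * Real.exp (-s * t) := by
    refine (setIntegral_eq_integral_of_forall_compl_eq_zero fun t ht => ?_).symm
    rw [mittagLefflerDensity, if_neg (by simpa using ht), zero_mul]
  rw [h0, setIntegral_congr_fun measurableSet_Ioi fun t ht => density_mul_exp_eq_tsum ht]
  have hsum := hasSum_integral_of_summable_integral_norm
    (μ := volume.restrict (Set.Ioi 0)) (F := laplaceTerm ν h lam s)
    (integrableOn_laplaceTerm hν hh hs) (by
      simp only [integral_norm_laplaceTerm hν hh hlam hs]
      exact ((hasSum_ascPochhammer_mul_pow h (by rwa [abs_of_pos hq0])).mul_left _).summable)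
  simp only [integral_laplaceTerm hν hh hs] at hsum
  rw [hsum.unique ((hasSum_ascPochhammer_mul_pow h
    (by rwa [abs_neg, abs_of_pos hq0])).mul_left _), mul_one_div, sub_neg_eq_add,
    ← Real.mul_rpow hlam.le (by positivity), ← Real.div_rpow (by positivity) (by positivity)]
  congr 1
  field_simp
  ring

end Laplace

/-! ### Explicit form of `κ`. -/

section MGF

variable {Ω : Type*} [MeasurableSpace Ω] {P : Measure Ω} [IsProbabilityMeasure P]
  {X : Ω → ℝ} {ν h lam : ℝ}

theorem mgf_eq_of_large (hν : 0 < ν) (hh : 0 < h) (hlam : 0 < lam)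
    (hX : HasMittagLefflerLaw P X ν h lam) {θ : ℝ} (hθ : θ < 0) (hlt : lam < (-θ) ^ ν) :
    mgf X P θ = (lam / (lam + (-θ) ^ ν)) ^ h := by
  have := hX.1
  rw [← integral_density_mul_exp hν hh hlam (neg_pos.2 hθ) hlt, mgf,
    ← pdf.integral_pdf_smul (X := X) (μ := volume) (f := fun t => Real.exp (θ * t))
      (by fun_prop)]
  refine integral_congr_ae ?_
  filter_upwards [hX.2] with t ht
  rw [ht, neg_neg, smul_eq_mul]

theorem analyticOnNhd_laplaceTransform (hlam : 0 < lam) :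
    AnalyticOnNhd ℝ (fun θ : ℝ => (lam / (lam + (-θ) ^ ν)) ^ h) (Set.Iio 0) := by
  have h1 : AnalyticOnNhd ℝ (fun θ : ℝ => Real.exp (Real.log (lam / (lam +
      Real.exp (Real.log (-θ) * ν))) * h)) (Set.Iio 0) := by
    intro θ hθ
    have hθ' : 0 < -θ := neg_pos.2 hθ
    have ha : AnalyticAt ℝ (fun θ : ℝ => lam + Real.exp (Real.log (-θ) * ν)) θ :=
      analyticAt_const.add (((analyticAt_id.neg.log hθ').mul analyticAt_const).rexp)
    have hpos : 0 < lam + Real.exp (Real.log (-θ) * ν) := by positivity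
    exact (((analyticAt_const.div ha hpos.ne').log (div_pos hlam hpos)).mul analyticAt_const).rexp
  refine h1.congr isOpen_Iio fun θ hθ => ?_
  have hθ' : 0 < -θ := neg_pos.2 hθ
  have : 0 < lam / (lam + (-θ) ^ ν) := by
    have := Real.rpow_pos_of_pos hθ' ν
    positivity
  rw [Real.rpow_def_of_pos this, Real.rpow_def_of_pos hθ']

theorem mgf_eq_of_neg (hν : 0 < ν) (hh : 0 < h) (hlam : 0 < lam)
    (hX : HasMittagLefflerLaw P X ν h lam) {θ : ℝ} (hθ : θ < 0) :
    mgf X P θ = (lam / (lam + (-θ) ^ ν)) ^ h := by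
  have := hX.1
  have hXm := HasPDF.aemeasurable X P volume
  -- At this base point `(-θ) ^ ν = lam + 1 > lam`, so the series formula holds in a neighbourhood
  -- and the identity theorem applies.
  have hz : -(lam + 1) ^ (1 / ν) < 0 := neg_neg_of_pos (by positivity)
  refine (analyticOnNhd_mgf.mono (Iio_zero_subset_interior_integrableExpSet hXm
    hX.ae_pos)).eqOn_of_preconnected_of_eventuallyEq (analyticOnNhd_laplaceTransform hlam)
    isPreconnected_Iio (z₀ := -(lam + 1) ^ (1 / ν)) hz ?_ hθ
  have hc : ContinuousAt (fun θ : ℝ => (-θ) ^ ν) (-(lam + 1) ^ (1 / ν)) :=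
    (continuous_neg.rpow_const fun _ => Or.inr hν.le).continuousAt
  have hval : lam < (-(-(lam + 1) ^ (1 / ν))) ^ ν := by
    rw [neg_neg, ← Real.rpow_mul (by positivity), one_div_mul_cancel hν.ne', Real.rpow_one]
    linarith
  filter_upwards [hc.eventually_const_lt hval, Iio_mem_nhds hz] with t ht1 ht2
  exact mgf_eq_of_large hν hh hlam hX ht2 ht1

theorem logMGF_eq_of_nonpos (hν : 0 < ν) (hh : 0 < h) (hlam : 0 < lam)
    (hX : HasMittagLefflerLaw P X ν h lam) {θ : ℝ} (hθ : θ ≤ 0) :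
    logMGF P X θ = ((h * Real.log (lam / (lam + (-θ) ^ ν)) : ℝ) : EReal) := by
  rcases hθ.eq_or_lt with rfl | hθ
  · rw [logMGF_zero, neg_zero, Real.zero_rpow hν.ne', add_zero, div_self hlam.ne', Real.log_one,
      mul_zero, EReal.coe_zero]
  · have := hX.1
    have := Real.rpow_pos_of_pos (neg_pos.2 hθ) ν
    rw [logMGF_of_integrable (integrable_exp_mul_of_ae_pos (HasPDF.aemeasurable X P volume)
      hX.ae_pos hθ.le), cgf, mgf_eq_of_neg hν hh hlam hX hθ, Real.log_rpow (by positivity)]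

/-- Jensen's inequality, from the tangent line of the exponential at the mean. -/
theorem exp_neg_mul_integral_le_mgf (hX : Integrable X P) {s : ℝ}
    (hs : Integrable (fun ω => Real.exp (-s * X ω)) P) :
    Real.exp (-(s * ∫ ω, X ω ∂P)) ≤ mgf X P (-s) := by
  set m := ∫ ω, X ω ∂P
  have hXm : Integrable (fun ω => X ω - m) P := hX.sub (integrable_const _)
  have h1 : ∫ ω, Real.exp (-(s * m)) * (1 - s * (X ω - m)) ∂P = Real.exp (-(s * m)) := by
    rw [integral_const_mul, integral_sub (integrable_const _) (hXm.const_mul _),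
      integral_const_mul, integral_sub hX (integrable_const _)]
    simp [m]
  rw [← h1]
  refine integral_mono (((integrable_const _).sub (hXm.const_mul _)).const_mul _) hs fun ω => ?_
  calc Real.exp (-(s * m)) * (1 - s * (X ω - m))
      ≤ Real.exp (-(s * m)) * Real.exp (-(s * (X ω - m))) := by
        gcongr
        linarith [Real.add_one_le_exp (-(s * (X ω - m)))]
    _ = Real.exp (-s * X ω) := by
        rw [← Real.exp_add]
        ring_nf

theorem eventually_mul_rpow_lt {p : ℝ} (hp : 0 < p) (c : ℝ) {a : ℝ} (ha : 0 < a) :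
    ∀ᶠ s : ℝ in 𝓝[>] 0, c * s ^ p < a := by
  have h1 : Tendsto (fun s : ℝ => c * s ^ p) (𝓝 0) (𝓝 (c * 0 ^ p)) :=
    ((continuous_id.rpow_const fun _ => Or.inr hp.le).const_mul c).tendsto 0
  rw [Real.zero_rpow hp.ne', mul_zero] at h1
  exact (h1.mono_left nhdsWithin_le_nhds).eventually_lt_const ha

/-- Near `0` the logarithm `log (1 + s ^ ν / lam)` beats every linear function. -/
theorem exists_mul_lt_log (hν : 0 < ν) (hν1 : ν < 1) (hh : 0 < h) (hlam : 0 < lam) (x : ℝ) :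
    ∃ s > 0, s * x < h * Real.log ((lam + s ^ ν) / lam) := by
  obtain ⟨s, hs, hs1⟩ := ((eventually_mul_rpow_lt (sub_pos.2 hν1) (|x| * (lam + 1)) hh).and
    (Ioo_mem_nhdsGT one_pos)).exists
  have hs0 : 0 < s := hs1.1
  have hsν : 0 < s ^ ν := Real.rpow_pos_of_pos hs0 ν
  -- This replaces `lam + s ^ ν` by the constant `lam + 1` used in the choice of `s`.
  have hle : s ^ ν ≤ 1 := Real.rpow_le_one hs0.le hs1.2.le hν.le
  refine ⟨s, hs0, ?_⟩
  have hlog : s ^ ν / (lam + s ^ ν) ≤ Real.log ((lam + s ^ ν) / lam) := by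
    refine le_trans (le_of_eq ?_) (Real.one_sub_inv_le_log_of_pos (by positivity))
    field_simp
    ring
  have hsplit : s = s ^ (1 - ν) * s ^ ν := by
    rw [← Real.rpow_add hs0]
    simp
  calc s * x ≤ s * |x| := by gcongr; exact le_abs_self x
    _ = |x| * (lam + 1) * s ^ (1 - ν) * (s ^ ν / (lam + 1)) := by
        conv_lhs => rw [hsplit]
        field_simp
    _ < h * (s ^ ν / (lam + 1)) := by gcongr
    _ ≤ h * (s ^ ν / (lam + s ^ ν)) := by gcongr
    _ ≤ _ := by gcongr

theorem logMGF_eq_top_of_pos (hν : 0 < ν) (hν1 : ν < 1) (hh : 0 < h) (hlam : 0 < lam)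
    (hX : HasMittagLefflerLaw P X ν h lam) {θ : ℝ} (hθ : 0 < θ) : logMGF P X θ = ⊤ := by
  have := hX.1
  have hXm := HasPDF.aemeasurable X P volume
  refine logMGF_of_not_integrable hXm fun hint => ?_
  -- Positivity of `X` and `θ * X ≤ exp (θ * X)` give a finite mean.
  have hXint : Integrable X P := by
    refine (hint.const_mul θ⁻¹).mono' hXm.aestronglyMeasurable ?_
    filter_upwards [hX.ae_pos] with ω hω
    rw [Real.norm_eq_abs, abs_of_pos hω, inv_mul_eq_div, le_div_iff₀' hθ]
    linarith [Real.add_one_le_exp (θ * X ω)]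
  obtain ⟨s, hs, hlt⟩ := exists_mul_lt_log hν hν1 hh hlam (∫ ω, X ω ∂P)
  have hsν : 0 < s ^ ν := Real.rpow_pos_of_pos hs ν
  have h1 := exp_neg_mul_integral_le_mgf hXint
    (integrable_exp_mul_of_ae_pos hXm hX.ae_pos (neg_nonpos.2 hs.le))
  rw [mgf_eq_of_neg hν hh hlam hX (neg_neg_of_pos hs), neg_neg,
    ← Real.le_log_iff_exp_le (by positivity), Real.log_rpow (by positivity), ← inv_div,
    Real.log_inv] at h1
  linarith

theorem Gamma_nat_add (hh : 0 < h) (r : ℕ) :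
    Real.Gamma (r + h) = (ascPochhammer ℝ r).eval h * Real.Gamma h := by
  induction r with
  | zero => simp
  | succ r ih =>
    rw [Nat.cast_succ, show (r : ℝ) + 1 + h = (r + h) + 1 by ring,
      Real.Gamma_add_one (by positivity), ih, ascPochhammer_succ_eval]
    ring

/-- Since `Γ(r + h) = (h)_r Γ(h)`, the rising factorials cancel and the exponential series remains.
-/
theorem genMittagLeffler_one (hh : 0 < h) (x : ℝ) :
    genMittagLeffler 1 (1 * h) h x = Real.exp x / Real.Gamma h := by
  rw [genMittagLeffler, Real.exp_eq_exp_ℝ, NormedSpace.exp_eq_tsum_div, ← tsum_div_const]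
  refine tsum_congr fun r => ?_
  have hA := (ascPochhammer_pos r h hh).ne'
  have hG := (Real.Gamma_pos_of_pos hh).ne'
  rw [one_mul, one_mul, Gamma_nat_add hh]
  field_simp

theorem ofReal_mittagLefflerDensity_one (hh : 0 < h) :
    (fun t => ENNReal.ofReal (mittagLefflerDensity 1 h lam t)) =ᵐ[volume] gammaPDF h lam := by
  -- The two densities may differ at `0`, where only `gammaPDF` uses its formula for the positive
  -- half-line.
  filter_upwards [Measure.ae_ne volume (0 : ℝ)] with t ht
  rcases ht.lt_or_gt with ht | ht
  · rw [mittagLefflerDensity, if_neg ht.not_gt, gammaPDF_of_neg ht, ENNReal.ofReal_zero]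
  · rw [mittagLefflerDensity, if_pos ht, gammaPDF_of_nonneg ht.le, genMittagLeffler_one hh,
      Real.rpow_one]
    ring_nf

theorem logMGF_eq_of_lt (hh : 0 < h) (hlam : 0 < lam)
    (hX : HasMittagLefflerLaw P X 1 h lam) {θ : ℝ} (hθ : θ < lam) :
    logMGF P X θ = ((h * Real.log (lam / (lam - θ)) : ℝ) : EReal) := by
  have := hX.1
  have hθ' : 0 < lam - θ := sub_pos.2 hθ
  have h1 : ∫⁻ ω, ENNReal.ofReal (Real.exp (θ * X ω)) ∂P =
      ENNReal.ofReal ((lam / (lam - θ)) ^ h) := by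
    rw [← pdf.lintegral_pdf_mul (X := X) (μ := volume)
      (f := fun t => ENNReal.ofReal (Real.exp (θ * t))) (by fun_prop)]
    -- Tilting a gamma density gives a multiple of the gamma density with rate `lam - θ`.
    have h2 : (fun t => pdf X P volume t * ENNReal.ofReal (Real.exp (θ * t))) =ᵐ[volume]
        fun t => ENNReal.ofReal ((lam / (lam - θ)) ^ h) * gammaPDF h (lam - θ) t := by
      filter_upwards [hX.pdf_ae_eq.trans (ofReal_mittagLefflerDensity_one hh)] with t ht
      rw [ht]
      rcases lt_or_ge t 0 with ht0 | ht0
      · simp [gammaPDF_of_neg ht0]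
      · have hG := Real.Gamma_pos_of_pos hh
        rw [gammaPDF_of_nonneg ht0, gammaPDF_of_nonneg ht0, ← ENNReal.ofReal_mul (by positivity),
          ← ENNReal.ofReal_mul (by positivity), Real.div_rpow hlam.le hθ'.le,
          show -((lam - θ) * t) = -(lam * t) + θ * t by ring, Real.exp_add]
        have := (Real.rpow_pos_of_pos hθ' h).ne'
        congr 1
        field_simp
    rw [lintegral_congr_ae h2, lintegral_const_mul' _ _ ENNReal.ofReal_ne_top,
      lintegral_gammaPDF_eq_one hh hθ', mul_one]
  rw [logMGF, h1, ENNReal.log_ofReal_of_pos (by positivity), Real.log_rpow (by positivity)]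

theorem logMGF_eq_top_of_le (hh : 0 < h) (hlam : 0 < lam)
    (hX : HasMittagLefflerLaw P X 1 h lam) {θ : ℝ} (hθ : lam ≤ θ) : logMGF P X θ = ⊤ := by
  rw [EReal.eq_top_iff_forall_lt]
  intro y
  -- At this slope below `lam` the function equals `y + 1`; monotonicity passes the bound on to `θ`.
  have hlt : lam - lam * Real.exp (-((y + 1) / h)) < lam := by
    have : 0 < lam * Real.exp (-((y + 1) / h)) := by positivity
    linarith
  refine lt_of_lt_of_le ?_ (logMGF_mono_of_ae_pos hX.ae_pos (hlt.le.trans hθ))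
  rw [logMGF_eq_of_lt hh hlam hX hlt, sub_sub_cancel, EReal.coe_lt_coe_iff,
    div_mul_cancel_left₀ hlam.ne', ← Real.exp_neg, neg_neg, Real.log_exp,
    mul_div_cancel₀ _ hh.ne']
  linarith

end MGF

/-! ### The rate function for `ν < 1`. -/

section FractionalCase

variable {ν h lam : ℝ} {κ : ℝ → EReal}

/-- The value at the slope `-s` of the affine functions whose supremum is the rate function, for
`ν < 1`. -/
noncomputable def slopeValue (ν h lam x s : ℝ) : ℝ :=
  h * Real.log ((lam + s ^ ν) / lam) - s * x

theorem coe_sub_eq_slopeValue (hκ : ∀ θ : ℝ,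
      κ θ = if θ ≤ 0 then ((h * Real.log (lam / (lam + (-θ) ^ ν)) : ℝ) : EReal) else ⊤)
    {s : ℝ} (hs : 0 ≤ s) (x : ℝ) :
    ((-s * x : ℝ) : EReal) - κ (-s) = (slopeValue ν h lam x s : EReal) := by
  rw [hκ, if_pos (neg_nonpos.2 hs), neg_neg, ← EReal.coe_sub, slopeValue, ← inv_div, Real.log_inv]
  congr 1
  ring

theorem slopeValue_le_legendre (hκ : ∀ θ : ℝ,
      κ θ = if θ ≤ 0 then ((h * Real.log (lam / (lam + (-θ) ^ ν)) : ℝ) : EReal) else ⊤)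
    {s : ℝ} (hs : 0 ≤ s) (x : ℝ) : (slopeValue ν h lam x s : EReal) ≤ legendre κ x := by
  rw [← coe_sub_eq_slopeValue hκ hs]
  exact le_legendre κ (-s) x

theorem legendre_le_of_slopeValue_le (hκ : ∀ θ : ℝ,
      κ θ = if θ ≤ 0 then ((h * Real.log (lam / (lam + (-θ) ^ ν)) : ℝ) : EReal) else ⊤)
    {x c : ℝ} (hc : ∀ s, 0 ≤ s → slopeValue ν h lam x s ≤ c) : legendre κ x ≤ (c : EReal) := by
  refine iSup_le fun θ => ?_
  rcases le_or_gt θ 0 with hθ | hθ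
  · have h1 := coe_sub_eq_slopeValue hκ (neg_nonneg.2 hθ) x
    rw [neg_neg] at h1
    rw [h1]
    exact_mod_cast hc _ (neg_nonneg.2 hθ)
  · rw [hκ, if_neg hθ.not_ge, EReal.sub_top]
    exact bot_le

theorem log_add_div_le (hlam : 0 < lam) {u : ℝ} (hu : 0 ≤ u) :
    Real.log ((lam + u) / lam) ≤ u / lam := by
  refine (Real.log_le_sub_one_of_pos (by positivity)).trans_eq ?_
  field_simp
  ring

/-- The threshold is where `h * s ^ ν / lam`, an upper bound for the logarithmic term, meets `s *
x`. -/
theorem slopeValue_nonpos_of_large (hν1 : ν < 1) (hh : 0 < h) (hlam : 0 < lam)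
    {x : ℝ} (hx : 0 < x) {s : ℝ} (hs : (h / (lam * x)) ^ (1 / (1 - ν)) ≤ s) :
    slopeValue ν h lam x s ≤ 0 := by
  have h1 : 0 < 1 - ν := sub_pos.2 hν1
  have hs0 : 0 < s := lt_of_lt_of_le (by positivity) hs
  have hsν : 0 < s ^ ν := Real.rpow_pos_of_pos hs0 ν
  have h2 : h / (lam * x) ≤ s ^ (1 - ν) := by
    have := Real.rpow_le_rpow (by positivity) hs h1.le
    rwa [← Real.rpow_mul (by positivity), one_div_mul_cancel h1.ne', Real.rpow_one] at this
  have hsplit : s ^ (1 - ν) * s ^ ν = s := by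
    rw [← Real.rpow_add hs0]
    simp
  have h3 : h * (s ^ ν / lam) ≤ s * x := by
    calc h * (s ^ ν / lam) = h / (lam * x) * (s ^ ν * x) := by field_simp
      _ ≤ s ^ (1 - ν) * (s ^ ν * x) := by gcongr
      _ = s * x := by rw [← mul_assoc, hsplit]
  have h4 := mul_le_mul_of_nonneg_left (log_add_div_le hlam hsν.le) hh.le
  rw [slopeValue]
  linarith

/-- Large slopes contribute nothing, so a maximiser exists on a compact interval. Some value is
positive while the value at `0` is `0`, so the maximiser is not `0`. -/
theorem exists_pos_forall_slopeValue_le (hν : 0 < ν) (hν1 : ν < 1) (hh : 0 < h) (hlam : 0 < lam)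
    {x : ℝ} (hx : 0 < x) :
    ∃ s > 0, ∀ t, 0 ≤ t → slopeValue ν h lam x t ≤ slopeValue ν h lam x s := by
  set R := (h / (lam * x)) ^ (1 / (1 - ν)) with hR
  have hR0 : 0 < R := by positivity
  have hcont : ContinuousOn (slopeValue ν h lam x) (Set.Icc 0 R) := by
    unfold slopeValue
    refine ContinuousOn.sub (ContinuousOn.mul continuousOn_const (ContinuousOn.log ?_ ?_))
      (by fun_prop)
    · exact ((continuous_const.add (continuous_id.rpow_const fun _ => Or.inr hν.le)).div_const
        lam).continuousOn
    · intro t ht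
      have := Real.rpow_nonneg ht.1 ν
      positivity
  obtain ⟨s, hs, hmax⟩ := isCompact_Icc.exists_isMaxOn ⟨0, le_rfl, hR0.le⟩ hcont
  obtain ⟨s₀, hs₀, hlt⟩ := exists_mul_lt_log hν hν1 hh hlam x
  have hpos₀ : 0 < slopeValue ν h lam x s₀ := sub_pos.2 hlt
  have hs₀R : s₀ ≤ R := by
    by_contra! hRs
    exact absurd (slopeValue_nonpos_of_large hν1 hh hlam hx hRs.le) (not_le.2 hpos₀)
  have hpos : 0 < slopeValue ν h lam x s := hpos₀.trans_le (hmax ⟨hs₀.le, hs₀R⟩)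
  refine ⟨s, hs.1.lt_of_ne ?_, fun t ht => ?_⟩
  · rintro rfl
    simp [slopeValue, Real.zero_rpow hν.ne', div_self hlam.ne'] at hpos
  · rcases le_total t R with htR | htR
    · exact hmax ⟨ht, htR⟩
    · exact (slopeValue_nonpos_of_large hν1 hh hlam hx htR).trans hpos.le

theorem legendre_eq_top_of_nonpos (hν : 0 < ν) (hh : 0 < h) (hlam : 0 < lam) (hκ : ∀ θ : ℝ,
      κ θ = if θ ≤ 0 then ((h * Real.log (lam / (lam + (-θ) ^ ν)) : ℝ) : EReal) else ⊤)
    {x : ℝ} (hx : x ≤ 0) : legendre κ x = ⊤ := by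
  rw [EReal.eq_top_iff_forall_lt]
  intro y
  -- With `s ^ ν = u` the logarithmic term is `|y| + 1`, and `-s * x` only helps.
  set u := lam * (Real.exp ((|y| + 1) / h) - 1) with hu
  have hu0 : 0 ≤ u :=
    mul_nonneg hlam.le (sub_nonneg.2 (Real.one_le_exp (by positivity)))
  have hs : 0 ≤ u ^ (1 / ν) := Real.rpow_nonneg hu0 _
  refine lt_of_lt_of_le ?_ (slopeValue_le_legendre hκ hs x)
  have h1 : (u ^ (1 / ν)) ^ ν = u := by
    rw [← Real.rpow_mul hu0, one_div_mul_cancel hν.ne', Real.rpow_one]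
  have h2 : (lam + u) / lam = Real.exp ((|y| + 1) / h) := by
    rw [hu]
    field_simp
    ring
  rw [EReal.coe_lt_coe_iff, slopeValue, h1, h2, Real.log_exp, mul_div_cancel₀ _ hh.ne']
  have := le_abs_self y
  nlinarith

theorem strictAntiOn_legendre (hν : 0 < ν) (hν1 : ν < 1) (hh : 0 < h) (hlam : 0 < lam)
    (hκ : ∀ θ : ℝ,
      κ θ = if θ ≤ 0 then ((h * Real.log (lam / (lam + (-θ) ^ ν)) : ℝ) : EReal) else ⊤) :
    StrictAntiOn (legendre κ) (Set.Ioi 0) := by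
  intro x _ y hy hxy
  -- The optimal slope for `y`, tested at `x`, gains `s * (y - x) > 0`.
  obtain ⟨s, hs, hmax⟩ := exists_pos_forall_slopeValue_le hν hν1 hh hlam hy
  refine (legendre_le_of_slopeValue_le hκ hmax).trans_lt
    (lt_of_lt_of_le ?_ (slopeValue_le_legendre hκ hs.le x))
  rw [EReal.coe_lt_coe_iff, slopeValue, slopeValue]
  have := mul_lt_mul_of_pos_left hxy hs
  linarith

/-- Up to `δ` the constant `ε` suffices; beyond it `s ^ ν ≤ s * δ ^ (ν - 1)`. For `x ≥ K` every
slope value is then at most `ε`. -/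
theorem exists_log_le_add_mul (hν : 0 < ν) (hν1 : ν < 1) (hh : 0 < h) (hlam : 0 < lam)
    {ε : ℝ} (hε : 0 < ε) :
    ∃ K : ℝ, ∀ s, 0 ≤ s → h * Real.log ((lam + s ^ ν) / lam) ≤ ε + s * K := by
  obtain ⟨δ, hδ, hδ0⟩ := ((eventually_mul_rpow_lt hν (h / lam) hε).and
    self_mem_nhdsWithin).exists
  have hδ0 : 0 < δ := hδ0
  refine ⟨h / lam * δ ^ (ν - 1), fun s hs => ?_⟩
  have h1 := mul_le_mul_of_nonneg_left (log_add_div_le hlam (Real.rpow_nonneg hs ν)) hh.le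
  have h2 : h * (s ^ ν / lam) = h / lam * s ^ ν := by ring
  rcases le_total s δ with hsδ | hsδ
  · have h3 : h / lam * s ^ ν ≤ h / lam * δ ^ ν := by gcongr
    have h4 : 0 ≤ s * (h / lam * δ ^ (ν - 1)) := by positivity
    linarith
  · have hs0 : 0 < s := hδ0.trans_le hsδ
    have h3 : s ^ (ν - 1) ≤ δ ^ (ν - 1) :=
      Real.rpow_le_rpow_of_nonpos hδ0 hsδ (by linarith)
    have h4 : h / lam * s ^ ν ≤ s * (h / lam * δ ^ (ν - 1)) := by
      calc h / lam * s ^ ν = s * (h / lam * s ^ (ν - 1)) := by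
            rw [Real.rpow_sub_one hs0.ne']
            field_simp
        _ ≤ _ := by gcongr
    linarith

theorem tendsto_legendre_atTop (hν : 0 < ν) (hν1 : ν < 1) (hh : 0 < h) (hlam : 0 < lam)
    (hκ : ∀ θ : ℝ,
      κ θ = if θ ≤ 0 then ((h * Real.log (lam / (lam + (-θ) ^ ν)) : ℝ) : EReal) else ⊤) :
    Tendsto (legendre κ) atTop (𝓝 0) := by
  have hκ0 : κ 0 = 0 := by
    rw [hκ, if_pos le_rfl, neg_zero, Real.zero_rpow hν.ne', add_zero, div_self hlam.ne',
      Real.log_one, mul_zero, EReal.coe_zero]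
  refine tendsto_order.2 ⟨fun a ha => Eventually.of_forall fun x =>
    ha.trans_le (legendre_nonneg hκ0 x), fun a ha => ?_⟩
  obtain ⟨ε, hε0, hεa⟩ := EReal.lt_iff_exists_real_btwn.1 ha
  obtain ⟨K, hK⟩ := exists_log_le_add_mul hν hν1 hh hlam (EReal.coe_pos.1 hε0)
  filter_upwards [eventually_ge_atTop K] with x hx
  refine (legendre_le_of_slopeValue_le hκ fun s hs => ?_).trans_lt hεa
  have := hK s hs
  have := mul_le_mul_of_nonneg_left hx hs
  rw [slopeValue]
  linarith

theorem not_isGood_of_tendsto_zero {I : ℝ → EReal} (h : Tendsto I atTop (𝓝 0)) : ¬ IsGood I := by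
  intro hgood
  obtain ⟨B, hB⟩ := (hgood 1 zero_le_one).bddAbove
  have h1 : ∀ᶠ x in atTop, I x < ((1 : ℝ) : EReal) :=
    h.eventually_lt_const (by exact_mod_cast zero_lt_one)
  obtain ⟨x, hx, hxB⟩ := (h1.and (eventually_gt_atTop B)).exists
  exact absurd (hB hx.le) (not_le.2 hxB)

theorem tendsto_top_of_lowerSemicontinuous {I : ℝ → EReal} (h : LowerSemicontinuous I)
    (h0 : I 0 = ⊤) : Tendsto I (𝓝[>] 0) (𝓝 ⊤) := by
  refine tendsto_order.2 ⟨fun a ha => ?_, fun a ha => absurd ha not_top_lt⟩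
  exact (lowerSemicontinuous_iff.1 h 0 a (by rw [← h0] at ha; exact ha)).filter_mono
    nhdsWithin_le_nhds

end FractionalCase

/-! ### The rate function for `ν = 1`. -/

section GammaCase

variable {h lam : ℝ} {κ : ℝ → EReal}

/-- This is `log z ≤ z - 1` at `z = (lam - θ) * x / h`, with equality at `θ = lam - h / x`. -/
theorem mul_sub_log_le (hh : 0 < h) (hlam : 0 < lam) {x : ℝ} (hx : 0 < x) {θ : ℝ} (hθ : θ < lam) :
    θ * x - h * Real.log (lam / (lam - θ)) ≤
      h * (lam * x / h - 1 - Real.log (lam * x / h)) := by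
  have hθ' : 0 < lam - θ := sub_pos.2 hθ
  have h1 := Real.log_le_sub_one_of_pos (show 0 < (lam - θ) * x / h by positivity)
  have h2 : Real.log ((lam - θ) * x / h) =
      Real.log (lam * x / h) - Real.log (lam / (lam - θ)) := by
    rw [← Real.log_div (by positivity) (by positivity)]
    congr 1
    field_simp
  rw [h2] at h1
  have h3 := mul_le_mul_of_nonneg_left h1 hh.le
  have h4 : h * ((lam - θ) * x / h - 1) = (lam - θ) * x - h := by field_simp
  have h5 : h * (lam * x / h) = lam * x := by field_simp
  rw [h4] at h3
  linarith

theorem mul_sub_log_eq (hh : 0 < h) {x : ℝ} (hx : 0 < x) :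
    (lam - h / x) * x - h * Real.log (lam / (lam - (lam - h / x))) =
      h * (lam * x / h - 1 - Real.log (lam * x / h)) := by
  rw [sub_sub_cancel, div_div_eq_mul_div]
  field_simp

theorem legendre_eq_of_pos (hh : 0 < h) (hlam : 0 < lam) (hκ : ∀ θ : ℝ,
      κ θ = if θ < lam then ((h * Real.log (lam / (lam - θ)) : ℝ) : EReal) else ⊤)
    {x : ℝ} (hx : 0 < x) :
    legendre κ x = ((h * (lam * x / h - 1 - Real.log (lam * x / h)) : ℝ) : EReal) := by
  refine le_antisymm (iSup_le fun θ => ?_) ?_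
  · rw [hκ]
    split_ifs with hθ
    · rw [← EReal.coe_sub, EReal.coe_le_coe_iff]
      exact mul_sub_log_le hh hlam hx hθ
    · rw [EReal.sub_top]
      exact bot_le
  · have h1 : lam - h / x < lam := sub_lt_self _ (by positivity)
    have h2 := le_legendre κ (lam - h / x) x
    rwa [hκ, if_pos h1, ← EReal.coe_sub, mul_sub_log_eq hh hx] at h2

theorem gamma_legendre_eq_top_of_nonpos (hh : 0 < h) (hlam : 0 < lam) (hκ : ∀ θ : ℝ,
      κ θ = if θ < lam then ((h * Real.log (lam / (lam - θ)) : ℝ) : EReal) else ⊤)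
    {x : ℝ} (hx : x ≤ 0) : legendre κ x = ⊤ := by
  rw [EReal.eq_top_iff_forall_lt]
  intro y
  set θ := lam - lam * Real.exp ((|y| + 1) / h) with hθ
  have hexp : 1 ≤ Real.exp ((|y| + 1) / h) := Real.one_le_exp (by positivity)
  have hθ0 : θ ≤ 0 := by nlinarith
  refine lt_of_lt_of_le ?_ (le_legendre κ θ x)
  rw [hκ, if_pos (hθ0.trans_lt hlam), ← EReal.coe_sub, EReal.coe_lt_coe_iff]
  have h1 : lam / (lam - θ) = Real.exp (-((|y| + 1) / h)) := by
    rw [hθ, sub_sub_cancel, div_mul_cancel_left₀ hlam.ne', Real.exp_neg]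
  rw [h1, Real.log_exp, mul_neg, mul_div_cancel₀ _ hh.ne']
  have := le_abs_self y
  nlinarith

theorem isGood_of_eq (hh : 0 < h) (hlam : 0 < lam) {I : ℝ → EReal} (hlsc : LowerSemicontinuous I)
    (hI : ∀ x : ℝ, I x =
      if 0 < x then ((h * (lam * x / h - 1 - Real.log (lam * x / h)) : ℝ) : EReal) else ⊤) :
    IsGood I := by
  intro η _
  refine (isCompact_Icc (a := (0 : ℝ)) (b := 2 * (η / h + Real.log 2) * h / lam)).of_isClosed_subset
    (hlsc.isClosed_preimage _) fun x hx => ?_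
  have hx' : I x ≤ η := hx
  rw [hI] at hx'
  split_ifs at hx' with hx0
  · rw [EReal.coe_le_coe_iff] at hx'
    set y := lam * x / h with hy
    have hy0 : 0 < y := by positivity
    -- Using `y / 2` rather than `y` leaves `y / 2 - log 2 ≤ y - 1 - log y`, hence a bound on `y`.
    have h1 := Real.log_le_sub_one_of_pos (half_pos hy0)
    rw [Real.log_div hy0.ne' two_ne_zero] at h1
    have h2 : y - 1 - Real.log y ≤ η / h := by rwa [le_div_iff₀' hh]
    have h3 : y ≤ 2 * (η / h + Real.log 2) := by linarith
    refine ⟨hx0.le, ?_⟩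
    rw [le_div_iff₀' hlam, ← div_le_iff₀ hh]
    exact h3
  · exact absurd hx' (not_le.2 (EReal.coe_lt_top η))

end GammaCase

end LDP

/-! ### Interior attainment in both regimes and the final assembly. -/

theorem mainTheorem1 {Ω : Type*} [MeasurableSpace Ω] (P : Measure Ω) [IsProbabilityMeasure P]
    (ν h lam : ℝ) (hν0 : 0 < ν) (hν1 : ν ≤ 1) (hh : 0 < h) (hlam : 0 < lam)
    (T : ℕ → Ω → ℝ) (hmeas : ∀ n, Measurable (T n)) (hindep : iIndepFun T P)
    (hlaw : ∀ n, LDP.HasMittagLefflerLaw P (T n) ν h lam)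
    (κ I : ℝ → EReal) (hκ : κ = LDP.logMGF P (T 0)) (hI : I = LDP.legendre κ) :
    -- the explicit form of the logarithmic moment generating function
    (ν < 1 → ∀ θ : ℝ,
      κ θ = if θ ≤ 0 then ((h * Real.log (lam / (lam + (-θ) ^ ν)) : ℝ) : EReal) else ⊤) ∧
    (ν = 1 → ∀ θ : ℝ,
      κ θ = if θ < lam then ((h * Real.log (lam / (lam - θ)) : ℝ) : EReal) else ⊤) ∧
    -- the large deviation principle for the empirical means
    LDP.SatisfiesLDP P (LDP.empiricalMean T) I ∧
    -- the case `ν = 1`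
    (ν = 1 →
      (∀ x : ℝ, I x =
        if 0 < x then ((h * (lam * x / h - 1 - Real.log (lam * x / h)) : ℝ) : EReal) else ⊤) ∧
      LDP.IsGood I) ∧
    -- the case `ν ∈ (0, 1)`
    (ν < 1 →
      (∀ x : ℝ, x ≤ 0 → I x = ⊤) ∧
      StrictAntiOn I (Set.Ioi 0) ∧
      Tendsto I (𝓝[>] 0) (𝓝 ⊤) ∧
      Tendsto I atTop (𝓝 0) ∧
      ¬ LDP.IsGood I) := by
  subst hκ hI
  have hpos := (hlaw 0).ae_pos
  have hfrac : ν < 1 → ∀ θ : ℝ, LDP.logMGF P (T 0) θ =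
      if θ ≤ 0 then ((h * Real.log (lam / (lam + (-θ) ^ ν)) : ℝ) : EReal) else ⊤ := by
    intro hlt θ
    split_ifs with hθ
    · exact LDP.logMGF_eq_of_nonpos hν0 hh hlam (hlaw 0) hθ
    · exact LDP.logMGF_eq_top_of_pos hν0 hlt hh hlam (hlaw 0) (not_le.1 hθ)
  have hgamma : ν = 1 → ∀ θ : ℝ, LDP.logMGF P (T 0) θ =
      if θ < lam then ((h * Real.log (lam / (lam - θ)) : ℝ) : EReal) else ⊤ := by
    intro h1 θ
    subst h1
    split_ifs with hθ
    · exact LDP.logMGF_eq_of_lt hh hlam (hlaw 0) hθ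
    · exact LDP.logMGF_eq_top_of_le hh hlam (hlaw 0) (not_lt.1 hθ)
  have hrate : ν = 1 → ∀ x : ℝ, LDP.legendre (LDP.logMGF P (T 0)) x =
      if 0 < x then ((h * (lam * x / h - 1 - Real.log (lam * x / h)) : ℝ) : EReal) else ⊤ := by
    intro h1 x
    split_ifs with hx
    · exact LDP.legendre_eq_of_pos hh hlam (hgamma h1) hx
    · exact LDP.gamma_legendre_eq_top_of_nonpos hh hlam (hgamma h1) (not_lt.1 hx)
  have hldp : LDP.SatisfiesLDP P (LDP.empiricalMean T) (LDP.legendre (LDP.logMGF P (T 0))) := by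
    refine LDP.satisfiesLDP_empiricalMean hmeas hindep
      (fun n => (hlaw n).identDistrib (hlaw 0)) fun x hx => ?_
    rcases hν1.lt_or_eq with hlt | heq
    · have hx0 : 0 < x := by
        by_contra! hx0
        exact hx (LDP.legendre_eq_top_of_nonpos hν0 hh hlam (hfrac hlt) hx0)
      obtain ⟨s, hs, hmax⟩ := LDP.exists_pos_forall_slopeValue_le hν0 hlt hh hlam hx0
      -- Strict positivity of `s` is essential: slope `0` is a boundary point of the domain of `κ`.
      have hint := LDP.Iio_zero_subset_interior_integrableExpSet (hmeas 0).aemeasurable hpos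
        (show -s ∈ Set.Iio 0 from neg_neg_of_pos hs)
      refine ⟨-s, hint, (LDP.legendre_le_of_slopeValue_le (hfrac hlt) hmax).trans_eq ?_⟩
      rw [← LDP.coe_sub_eq_slopeValue (hfrac hlt) hs.le, LDP.logMGF_of_integrable
        (show -s ∈ integrableExpSet (T 0) P from interior_subset hint), EReal.coe_sub]
    · have hx0 : 0 < x := by
        by_contra! hx0
        exact hx (LDP.gamma_legendre_eq_top_of_nonpos hh hlam (hgamma heq) hx0)
      have hlt : lam - h / x < lam := sub_lt_self _ (by positivity)
      have hsub : Set.Iio lam ⊆ integrableExpSet (T 0) P := fun θ hθ =>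
        LDP.integrable_of_logMGF_ne_top (hmeas 0).aemeasurable (by
          rw [hgamma heq, if_pos (Set.mem_Iio.1 hθ)]
          exact EReal.coe_ne_top _)
      refine ⟨lam - h / x, interior_maximal hsub isOpen_Iio hlt, ?_⟩
      rw [EReal.coe_sub, ← LDP.logMGF_of_integrable (hsub hlt), hgamma heq, if_pos hlt,
        ← EReal.coe_sub, LDP.mul_sub_log_eq hh hx0,
        LDP.legendre_eq_of_pos hh hlam (hgamma heq) hx0]
  refine ⟨hfrac, hgamma, hldp, fun h1 => ⟨hrate h1,
    LDP.isGood_of_eq hh hlam hldp.lowerSemicontinuous (hrate h1)⟩, fun hlt => ?_⟩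
  have hzero := LDP.tendsto_legendre_atTop hν0 hlt hh hlam (hfrac hlt)
  have htop := fun x (hx : x ≤ 0) => LDP.legendre_eq_top_of_nonpos hν0 hh hlam (hfrac hlt) hx
  exact ⟨htop, LDP.strictAntiOn_legendre hν0 hlt hh hlam (hfrac hlt),
    LDP.tendsto_top_of_lowerSemicontinuous hldp.lowerSemicontinuous (htop 0 le_rfl), hzero,
    LDP.not_isGood_of_tendsto_zero hzero⟩
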